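/- Conventions. Triangulated categories satisfy the octahedral axiom, and t-structures are indexed cohomologically. Let $\mathcal S$ be a triangulated category with a t-structure $(\mathcal S^{\le 0},\mathcal S^{\ge 0})$ that is bounded above, meaning $\mathcal S=\bigcup_{n\in\mathbb N}\mathcal S^{\le n}$, and for $i\in\mathbb N$ put $\mathcal M_i=\mathcal S^{\ge i}$. A sequence $E_*=(E_1\to E_2\to E_3\to\cdots)$ in $\mathcal S$ is *Cauchy* if for every $i\in\mathbb N$ there is an $N$ such that, for all $m'>m\ge N$, in any distinguished triangle $E_m\to E_{m'}\to D\to\Sigma E_m$ the object $D$ lies in $\mathcal M_i$. The homotopy colimit $\operatorname{hocolim} A_*$ of a sequence $A_*$ in a triangulated category, whose coproduct $\coprod_i A_i$ exists, is the third object in a distinguished triangle $\coprod_i A_i\xrightarrow{\mathrm{id}-\mathrm{shift}}\coprod_i A_i\to\operatorname{hocolim} A_*\to\Sigma\coprod_i A_i$. Let $\mathcal T$ be a triangulated category, and let $F\colon\mathcal S\to\mathcal T$ be a *good extension* with respect to $\{\mathcal M_i\}$: a fully faithful triangulated functor such that, for every Cauchy sequence $E_*$ in $\mathcal S$, the coproduct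 $\coprod_i F(E_i)$ exists in $\mathcal T$ and the natural map $\operatorname{colim}_i\operatorname{Hom}_{\mathcal S}(-,E_i)\to\operatorname{Hom}_{\mathcal T}(F(-),\operatorname{hocolim} F(E_*))$ is an isomorphism of functors $\mathcal S^{\mathrm{op}}\to\mathrm{Ab}$. Let $\widetilde{\mathcal S}=\mathfrak L'(\mathcal S)\subset\mathcal T$ be the full subcategory of all objects isomorphic to $\operatorname{hocolim} F(E_*)$ for some Cauchy sequence $E_*$ in $\mathcal S$. Then $\widetilde{\mathcal S}$ is a triangulated subcategory of $\mathcal T$, and it has a t-structure $(\widetilde{\mathcal S}^{\le 0},\widetilde{\mathcal S}^{\ge 0})$ whose aisle $\widetilde{\mathcal S}^{\le 0}$ is the essential image $F(\mathcal S^{\le 0})$, such that: (i) The essential image of $F$ is $\widetilde{\mathcal S}^{-}=\bigcup_{n\in\mathbb N}\widetilde{\mathcal S}^{\le n}$, and the t-structure of $\mathcal S$ is the inverse image under $F$ of the one on $\widetilde{\mathcal S}$: for $A\in\mathcal S$ and $n\in\mathbb Z$, $A\in\mathcal S^{\le n}$ if and only if $F(A)\in\widetilde{\mathcal S}^{\le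 n}$, and $A\in\mathcal S^{\ge n}$ if and only if $F(A)\in\widetilde{\mathcal S}^{\ge n}$. (ii) Let $X_*$ be a Cauchy sequence in $\mathcal S$, let $X=\operatorname{hocolim}F(X_*)$, and let $n\in\mathbb Z$. Then the sequence $X_*^{\le n}$ eventually stabilizes (there is an $N$ such that $X_i^{\le n}\to X_j^{\le n}$ is an isomorphism for all $j\ge i\ge N$), so that $\operatorname{colim}X_*^{\le n}$ exists in $\mathcal S$; and the natural map $F(\operatorname{colim}X_*^{\le n})\to X^{\le n}$, the unique one compatible with the composites $F(X_i^{\le n})\to F(X_i)\to X$, is an isomorphism. -/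

import Mathlib

open CategoryTheory CategoryTheory.Limits CategoryTheory.Pretriangulated
  CategoryTheory.Triangulated

universe v₁ v₂ u₁ u₂

noncomputable section

namespace MetricCompletion

section Sequences

variable {C : Type u₁} [Category.{v₁} C]

/-- A sequence `A 0 ⟶ A 1 ⟶ ⋯` eventually stabilizes if there is an `N` such that all the maps
`A i ⟶ A j` with `N ≤ i ≤ j` are isomorphisms. -/
def EventuallyStable (A : ℕ ⥤ C) : Prop :=
  ∃ N : ℕ, ∀ (i j : ℕ) (hij : i ≤ j), N ≤ i → IsIso (A.map (homOfLE hij))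

end Sequences

section Triangulated

variable {C : Type u₁} [Category.{v₁} C] [Preadditive C] [HasZeroObject C] [HasShift C ℤ]
  [∀ n : ℤ, (shiftFunctor C n).Additive] [Pretriangulated C]

/-- A sequence `E` is Cauchy with respect to the metric `M` if for every `i` there is an `N` such
that, for all `N ≤ m < m'`, in any distinguished triangle `E m ⟶ E m' ⟶ D ⟶ (E m)⟦1⟧` starting
with the map of the sequence, the object `D` belongs to `M i`. -/
def IsCauchy (M : ℕ → ObjectProperty C) (E : ℕ ⥤ C) : Prop :=
  ∀ i : ℕ, ∃ N : ℕ, ∀ (m m' : ℕ) (h : m < m'), N ≤ m →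
    ∀ (D : C) (p : E.obj m' ⟶ D) (q : D ⟶ (E.obj m)⟦(1 : ℤ)⟧),
      Triangle.mk (E.map (homOfLE h.le)) p q ∈ distTriang C → M i D

/-- The map `id - shift : ∐ E i ⟶ ∐ E i` on a coproduct of the terms of a sequence. -/
def oneSubShift (E : ℕ ⥤ C) {b : Cofan E.obj} (hb : IsColimit b) : b.pt ⟶ b.pt :=
  Cofan.IsColimit.desc hb
    (fun i ↦ b.inj i - E.map (homOfLE (Nat.le_succ i)) ≫ b.inj (i + 1))

/-- The cocone `c` exhibits `c.pt` as a homotopy colimit of the sequence `E`: the coproduct of the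
`E i` exists, and there is a distinguished triangle
`∐ E i ⟶ ∐ E i ⟶ c.pt ⟶ (∐ E i)⟦1⟧`, whose first map is `id - shift` and
whose second map has the legs of `c` as its components. -/
def IsHomotopyColimit {E : ℕ ⥤ C} (c : Cocone E) : Prop :=
  ∃ (b : Cofan E.obj) (hb : IsColimit b) (δ : c.pt ⟶ b.pt⟦(1 : ℤ)⟧),
    Triangle.mk (oneSubShift E hb) (Cofan.IsColimit.desc hb (fun i ↦ c.ι.app i)) δ ∈ distTriang C

/-- The t-structure is bounded above: every object belongs to `C^{≤ n}` for some `n`. -/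
def IsBoundedAbove (t : TStructure C) : Prop :=
  ∀ X : C, ∃ n : ℕ, t.le n X

/-- The metric `M i = C^{≥ i}` of a t-structure. -/
def tMetric (t : TStructure C) : ℕ → ObjectProperty C :=
  fun i ↦ t.ge i

end Triangulated

section GoodExtensions

variable {S : Type u₁} [Category.{v₁} S] [Preadditive S] [HasZeroObject S] [HasShift S ℤ]
  [∀ n : ℤ, (shiftFunctor S n).Additive] [Pretriangulated S]
  {T : Type u₂} [Category.{v₂} T] [Preadditive T] [HasZeroObject T] [HasShift T ℤ]
  [∀ n : ℤ, (shiftFunctor T n).Additive] [Pretriangulated T]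

/-- The restricted Yoneda functor, sending `X : T` to the presheaf of abelian groups
`Hom(F(-), X)` on `S`. -/
def restrictedYoneda (F : S ⥤ T) : T ⥤ Sᵒᵖ ⥤ AddCommGrpCat.{v₂} :=
  preadditiveYoneda ⋙ (Functor.whiskeringLeft Sᵒᵖ Tᵒᵖ AddCommGrpCat.{v₂}).obj F.op

/-- `F` is a good extension with respect to the metric `M`: it is a fully faithful triangulated
functor such that, for every Cauchy sequence `E` in `S`, the coproduct of the `F (E i)` exists
in `T`, and the restricted Yoneda functor `𝒴` takes the homotopy colimit of `F (E i)` to the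
colimit of the presheaves `𝒴 (F (E i))`, that is, the natural map
`colim 𝒴 (F (E i)) ⟶ 𝒴 (hocolim F (E i))` is an isomorphism. As `F` is fully faithful,
`𝒴 (F (E i)) = Hom(F(-), F (E i))` is the presheaf `Hom(-, E i)` represented by `E i`. -/
structure IsGoodExtension (F : S ⥤ T) [F.CommShift ℤ] (M : ℕ → ObjectProperty S) : Prop where
  full : F.Full
  faithful : F.Faithful
  isTriangulated : F.IsTriangulated
  hasCoproduct (E : ℕ ⥤ S) (hE : IsCauchy M E) : HasCoproduct (fun i ↦ F.obj (E.obj i))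
  isColimit (E : ℕ ⥤ S) (hE : IsCauchy M E) (c : Cocone (E ⋙ F)) (hc : IsHomotopyColimit c) :
    Nonempty (IsColimit ((restrictedYoneda F).mapCocone c))

/-- The property of objects of `T` defining the full subcategory `𝔏'(S)`: to be isomorphic to the
homotopy colimit of the image under `F` of a Cauchy sequence in `S`. -/
def LPrime (F : S ⥤ T) (M : ℕ → ObjectProperty S) : ObjectProperty T :=
  fun X ↦ ∃ (E : ℕ ⥤ S) (_ : IsCauchy M E) (c : Cocone (E ⋙ F)) (_ : IsHomotopyColimit c),
    Nonempty (c.pt ≅ X)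

end GoodExtensions

end MetricCompletion

end

/-!
The proof characterizes the objects of `𝔏'(S)` without mentioning sequences. Call a morphism
`f : Y ⟶ X` of `T` `n`-colocal if composition with `f` is bijective on maps out of the image of
`S^{≤ n}` (`((t.le n).map F).isColocal f`), and call `X` approximable (`IsApproximable`) if

* `X` is left orthogonal to everything that is right orthogonal to the image of `F`, and
* for every `n` there is an `n`-colocal morphism `F A ⟶ X` with `A` in `S`.

A homotopy colimit `X` of a Cauchy sequence `E` is approximable. The cone of `E i ⟶ E j` lies in
`S^{≥ n + 1}` for large `i`, so `Hom(A, E i)` is constant for `A` in `S^{≤ n}`, and the good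
extension property makes `F (E i) ⟶ X` `n`-colocal; the orthogonality holds since `X` is built from
coproducts of objects `F (E i)`. Conversely, truncating the approximations of an approximable `X`
gives `A n` in `S^{≤ n}` with `n`-colocal `F (A n) ⟶ X`. By universality these form a sequence,
which is Cauchy, and the comparison `hocolim F (A n) ⟶ X` is `n`-colocal for every `n`. As `t` is
bounded above, its cone is right orthogonal to the whole image of `F`; by the first condition the
cone is left orthogonal to itself, so it vanishes (`isIso_of_isColocal`). This is
`IsGoodExtension.lPrime_eq`.

The point of the characterization is that cones can be handled without lifting a morphism of `T` to
a morphism of Cauchy sequences, whose homotopy colimit would only be determined up to phantom maps: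
orthogonality passes to cones, and approximations of a cone come from the five lemma
(`isTriangulated_isApproximable`). The truncation triangle of `X` is the octahedron on
`F (A^{≤ n}) ⟶ F A ⟶ X`, for an `(n + 1)`-colocal `F A ⟶ X` (`IsApproximable.exists_triangle`).
Finally, both `F (colim E^{≤ n}) ⟶ X` and `X^{≤ n} ⟶ X` are `n`-colocal with source in the image of
`S^{≤ n}`, hence canonically isomorphic.
-/

noncomputable section

namespace MetricCompletion

/-! ### Colocal morphisms in triangulated categories -/

section Colocal

variable {C : Type u₁} [Category.{v₁} C] {P : ObjectProperty C}

lemma isColocal_antitone {Q : ObjectProperty C} (h : P ≤ Q) {X Y : C} {f : X ⟶ Y}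
    (hf : Q.isColocal f) : P.isColocal f :=
  fun L hL ↦ hf L (h _ hL)

lemma isColocal_shift [HasShift C ℤ] {Q : ObjectProperty C} {X Y : C} {f : X ⟶ Y}
    (hf : Q.isColocal f) (a : ℤ) (h : ∀ L, P L → Q (L⟦-a⟧)) :
    P.isColocal (f⟦a⟧') := by
  intro L hL
  have e := (shiftEquiv C a).symm.toAdjunction
  have key : (fun g : L ⟶ X⟦a⟧ ↦ g ≫ f⟦a⟧') =
      (e.homEquiv L Y) ∘ (fun g : L⟦-a⟧ ⟶ X ↦ g ≫ f) ∘ (e.homEquiv L X).symm := by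
    ext g
    exact ((e.homEquiv_naturality_right ((e.homEquiv L X).symm g) f).trans
      (congrArg (· ≫ f⟦a⟧') ((e.homEquiv L X).apply_symm_apply g))).symm
  rw [key]
  exact (Equiv.bijective _).comp ((hf _ (h L hL)).comp (Equiv.bijective _))

variable [Preadditive C]

lemma eq_zero_of_isColocal {X Y L : C} {f : X ⟶ Y} (hf : P.isColocal f) (hL : P L)
    {g : L ⟶ X} (hg : g ≫ f = 0) : g = 0 :=
  (hf L hL).1 (by simpa using hg)

lemma rightOrthogonal_shift [HasShift C ℤ] [∀ n : ℤ, (shiftFunctor C n).Additive]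
    {Q : ObjectProperty C} {X : C} (hX : Q.rightOrthogonal X) (a : ℤ) (h : ∀ L, P L → Q (L⟦-a⟧)) :
    P.rightOrthogonal (X⟦a⟧) := by
  intro L g hL
  apply (shiftFunctor C (-a)).map_injective
  rw [← cancel_mono (shiftShiftNeg X a).hom, Functor.map_zero, zero_comp]
  exact hX _ (h L hL)

variable [HasShift C ℤ] [HasZeroObject C] [∀ n : ℤ, (shiftFunctor C n).Additive] [Pretriangulated C]

/-- The five lemma for the functors `Hom(L, -)`, with `L` in `P`. -/
lemma isColocal_hom₃ {T T' : Triangle C} (hT : T ∈ distTriang C) (hT' : T' ∈ distTriang C)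
    (φ : T ⟶ T') (h₁ : P.isColocal φ.hom₁) (h₂ : P.isColocal φ.hom₂)
    (h₁' : P.isColocal (φ.hom₁⟦(1 : ℤ)⟧')) (h₂' : P.isColocal (φ.hom₂⟦(1 : ℤ)⟧')) :
    P.isColocal φ.hom₃ := by
  intro L hL
  constructor
  · intro g₁ g₂ hg
    rw [← sub_eq_zero] at hg ⊢
    replace hg : (g₁ - g₂) ≫ φ.hom₃ = 0 := by simpa using hg
    generalize g₁ - g₂ = g at hg ⊢
    obtain ⟨k, rfl⟩ := Triangle.coyoneda_exact₃ _ hT g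
      (eq_zero_of_isColocal h₁' hL (by rw [Category.assoc, φ.comm₃, reassoc_of% hg, zero_comp]))
    obtain ⟨l, hl⟩ := Triangle.coyoneda_exact₂ _ hT' (k ≫ φ.hom₂)
      (by rw [Category.assoc, ← φ.comm₂, ← Category.assoc, hg])
    obtain ⟨l', rfl⟩ := (h₁ L hL).2 l
    have hk : k = l' ≫ T.mor₁ := (h₂ L hL).1 (by simp [hl])
    rw [hk, Category.assoc, comp_distTriang_mor_zero₁₂ _ hT, comp_zero]
  · intro y
    obtain ⟨z, hz⟩ := (h₁' L hL).2 (y ≫ T'.mor₃)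
    dsimp only at hz
    obtain ⟨w, rfl⟩ := Triangle.coyoneda_exact₁ _ hT z (eq_zero_of_isColocal h₂' hL (by
      rw [Category.assoc, ← Functor.map_comp, φ.comm₁, Functor.map_comp, reassoc_of% hz,
        comp_distTriang_mor_zero₃₁ _ hT', comp_zero]))
    obtain ⟨v, hv⟩ := Triangle.coyoneda_exact₃ _ hT' (y - w ≫ φ.hom₃) (by
      rw [Preadditive.sub_comp, Category.assoc, ← φ.comm₃, ← hz, Category.assoc, sub_self])
    obtain ⟨v', rfl⟩ := (h₂ L hL).2 v
    refine ⟨w + v' ≫ T.mor₂, ?_⟩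
    dsimp only at hv ⊢
    rw [Preadditive.add_comp, Category.assoc, φ.comm₂, ← Category.assoc, ← hv,
      add_sub_cancel]

/-- The long exact sequence of `Hom(L, -)`: if a morphism and its shift are `P`-colocal, then
its cone receives no nonzero map from `P`. -/
lemma rightOrthogonal_obj₃ {T : Triangle C} (hT : T ∈ distTriang C) (h : P.isColocal T.mor₁)
    (h' : P.isColocal (T.mor₁⟦(1 : ℤ)⟧')) : P.rightOrthogonal T.obj₃ := by
  intro L k hL
  obtain ⟨l, rfl⟩ := Triangle.coyoneda_exact₃ _ hT k (eq_zero_of_isColocal h' hL (by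
    rw [Category.assoc, comp_distTriang_mor_zero₃₁ _ hT, comp_zero]))
  obtain ⟨l', rfl⟩ := (h L hL).2 l
  dsimp only
  rw [Category.assoc, comp_distTriang_mor_zero₁₂ _ hT, comp_zero]

/-- A morphism that is colocal for a shift-stable `P` is an isomorphism as soon as its source and
target are left orthogonal to everything that is right orthogonal to `P`: its cone is then left
orthogonal to itself. -/
lemma isIso_of_isColocal [P.IsStableUnderShift ℤ] {X Y : C} {f : X ⟶ Y} (hf : P.isColocal f)
    (hX : P.rightOrthogonal.leftOrthogonal X) (hY : P.rightOrthogonal.leftOrthogonal Y) :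
    IsIso f := by
  obtain ⟨Z, g, h, hT⟩ := distinguished_cocone_triangle f
  have hZ : P.rightOrthogonal Z := rightOrthogonal_obj₃ hT hf
    (isColocal_shift hf 1 (fun L hL ↦ P.le_shift _ _ hL))
  have hZ' : P.rightOrthogonal.leftOrthogonal Z :=
    ObjectProperty.ext_of_isTriangulatedClosed₃ _ _ hT hX hY
  exact (Triangle.isZero₃_iff_isIso₁ _ hT).1 ((IsZero.iff_id_eq_zero Z).2 (hZ' _ hZ))

end Colocal

/-! ### Homotopy colimits -/

section HomotopyColimits

variable {C : Type u₁} [Category.{v₁} C] [Preadditive C]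

lemma inj_oneSubShift (E : ℕ ⥤ C) {b : Cofan E.obj} (hb : IsColimit b) (i : ℕ) :
    b.inj i ≫ oneSubShift E hb = b.inj i - E.map (homOfLE (Nat.le_succ i)) ≫ b.inj (i + 1) :=
  Cofan.IsColimit.fac _ _ _

lemma oneSubShift_desc (E : ℕ ⥤ C) {b : Cofan E.obj} (hb : IsColimit b) {X : C}
    (f : ∀ i, E.obj i ⟶ X) (hf : ∀ i, E.map (homOfLE (Nat.le_succ i)) ≫ f (i + 1) = f i) :
    oneSubShift E hb ≫ Cofan.IsColimit.desc hb f = 0 :=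
  Cofan.IsColimit.hom_ext hb _ _ fun i ↦ by
    rw [← Category.assoc, inj_oneSubShift, Preadditive.sub_comp, Category.assoc,
      Cofan.IsColimit.fac, Cofan.IsColimit.fac, hf, sub_self, comp_zero]

variable [HasZeroObject C] [HasShift C ℤ] [∀ n : ℤ, (shiftFunctor C n).Additive]
  [Pretriangulated C]

lemma exists_isHomotopyColimit (E : ℕ ⥤ C) [HasCoproduct E.obj] :
    ∃ c : Cocone E, IsHomotopyColimit c := by
  have hb := coproductIsCoproduct E.obj
  obtain ⟨X, p, δ, hT⟩ := distinguished_cocone_triangle (oneSubShift E hb)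
  let b : Cofan E.obj := Cofan.mk _ (Sigma.ι E.obj)
  have hp : oneSubShift E hb ≫ p = 0 := comp_distTriang_mor_zero₁₂ _ hT
  let c : Cocone E :=
    { pt := X
      ι := NatTrans.ofSequence (fun i ↦ b.inj i ≫ p) (fun i ↦ by
        have := b.inj i ≫= hp
        rw [← Category.assoc, inj_oneSubShift, Preadditive.sub_comp, comp_zero, sub_eq_zero,
          Category.assoc] at this
        simpa using this.symm) }
  refine ⟨c, b, hb, δ, ?_⟩
  have : Cofan.IsColimit.desc hb (fun i ↦ c.ι.app i) = p :=
    Cofan.IsColimit.hom_ext hb _ _ fun i ↦ Cofan.IsColimit.fac _ _ _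
  rw [this]
  exact hT

/-- A homotopy colimit is a weak colimit. -/
lemma IsHomotopyColimit.exists_desc {E : ℕ ⥤ C} {c : Cocone E} (hc : IsHomotopyColimit c)
    (d : Cocone E) : ∃ f : c.pt ⟶ d.pt, ∀ i, c.ι.app i ≫ f = d.ι.app i := by
  obtain ⟨b, hb, δ, hT⟩ := hc
  obtain ⟨f, hf⟩ : ∃ f : c.pt ⟶ d.pt, Cofan.IsColimit.desc hb (fun i ↦ d.ι.app i) =
      Cofan.IsColimit.desc hb (fun i ↦ c.ι.app i) ≫ f :=
    Triangle.yoneda_exact₂ _ hT (Cofan.IsColimit.desc hb (fun i ↦ d.ι.app i))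
      (oneSubShift_desc E hb _ (fun i ↦ d.w _))
  refine ⟨f, fun i ↦ ?_⟩
  have := b.inj i ≫= hf
  rw [Cofan.IsColimit.fac, ← Category.assoc, Cofan.IsColimit.fac] at this
  exact this.symm

/-- Left orthogonality passes from the terms of a sequence to their coproduct, hence to the
homotopy colimit. -/
lemma IsHomotopyColimit.leftOrthogonal {E : ℕ ⥤ C} {c : Cocone E} (hc : IsHomotopyColimit c)
    (Q : ObjectProperty C) [Q.IsStableUnderShift ℤ] (hE : ∀ i, Q.leftOrthogonal (E.obj i)) :
    Q.leftOrthogonal c.pt := by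
  obtain ⟨b, hb, δ, hT⟩ := hc
  have h : Q.leftOrthogonal b.pt := fun Y f hY ↦
    Cofan.IsColimit.hom_ext hb _ _ fun i ↦ (hE i _ hY).trans comp_zero.symm
  exact ObjectProperty.ext_of_isTriangulatedClosed₃ _ _ hT h h

end HomotopyColimits

section

variable {S : Type u₁} [Category.{v₁} S] [Preadditive S] [HasZeroObject S] [HasShift S ℤ]
  [∀ n : ℤ, (shiftFunctor S n).Additive] [Pretriangulated S]

/-! ### Colocality with respect to the aisles of a t-structure -/

section Aisles

variable (t : TStructure S)

/-- A morphism with cone in `S^{≥ n + 1}` is colocal for `S^{≤ n}`: neither the cone nor its shift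
by `-1` receives nonzero maps from `S^{≤ n}`. -/
lemma isColocal_le_mor₁ {A : Triangle S} (hA : A ∈ distTriang S) (n₀ n₁ : ℤ) (h : n₀ + 1 = n₁)
    (h₃ : t.ge n₁ A.obj₃) : (t.le n₀).isColocal A.mor₁ := by
  have := TStructure.IsGE.mk h₃
  intro L hL
  have := TStructure.IsLE.mk hL
  constructor
  · intro g₁ g₂ hg
    replace hg : g₁ ≫ A.mor₁ = g₂ ≫ A.mor₁ := hg
    rw [← sub_eq_zero, ← Preadditive.sub_comp] at hg
    rw [← sub_eq_zero]
    have := t.isGE_shift A.obj₃ n₁ (-1) (n₁ + 1)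
    obtain ⟨k, hk⟩ := Triangle.coyoneda_exact₂ _ (inv_rot_of_distTriang _ hA) (g₁ - g₂) hg
    rw [hk, t.zero_of_isLE_of_isGE k n₀ (n₁ + 1) (by lia) inferInstance this]
    exact zero_comp
  · intro g
    obtain ⟨k, rfl⟩ := Triangle.coyoneda_exact₂ _ hA g (t.zero _ n₀ n₁)
    exact ⟨k, rfl⟩

/-- A partial converse of `isColocal_le_mor₁`, with a loss of one degree. -/
lemma ge_obj₃_of_isColocal {A : Triangle S} (hA : A ∈ distTriang S) (n : ℤ)
    (h : (t.le n).isColocal A.mor₁) : t.ge n A.obj₃ := by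
  have h' : (t.le (n - 1)).rightOrthogonal A.obj₃ :=
    rightOrthogonal_obj₃ hA (isColocal_antitone (t.le_monotone (by lia)) h)
      (isColocal_shift h 1 (fun L hL ↦ t.le_shift (n - 1) (-1) n (by lia) L hL))
  rw [t.ge_iff_isGE, t.isGE_iff_orthogonal (n - 1) n (by lia)]
  exact fun L g hL ↦ h' g hL.le

lemma isColocal_truncLEι (n : ℤ) (X : S) : (t.le n).isColocal ((t.truncLEι n).app X) :=
  isColocal_le_mor₁ t (t.triangleLEGE_distinguished n _ rfl X) n _ rfl
    (TStructure.ge_of_isGE t ((t.truncGE (n + 1)).obj X) _)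

end Aisles

variable {T : Type u₂} [Category.{v₂} T] 
  (t : TStructure S) (F : S ⥤ T)

/-! ### The images of the aisles -/

lemma map_le_mono {n m : ℤ} (h : n ≤ m) : (t.le n).map F ≤ (t.le m).map F := by
  rintro X ⟨A, hA, e⟩
  exact ⟨A, t.le_monotone h _ hA, e⟩

lemma map_le_shift [HasShift T ℤ] [F.CommShift ℤ] (n a n' : ℤ) (h : a + n' = n) (X : T)
    (hX : (t.le n).map F X) : (t.le n').map F (X⟦a⟧) := by
  obtain ⟨A, hA, ⟨e⟩⟩ := hX
  exact ⟨A⟦a⟧, t.le_shift n a n' h A hA,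
    ⟨(F.commShiftIso a).app A ≪≫ (shiftFunctor T a).mapIso e⟩⟩

variable {t F}

lemma isColocal_map_le_shift [HasShift T ℤ] [F.CommShift ℤ] {X Y : T} {f : X ⟶ Y} {n : ℤ}
    (hf : ((t.le n).map F).isColocal f) (a n' : ℤ) (h : a + n' = n) :
    ((t.le n').map F).isColocal (f⟦a⟧') :=
  isColocal_shift hf a (map_le_shift t F n' (-a) n (by lia))

lemma isColocal_map_le_iff {n : ℤ} {X Y : T} (f : X ⟶ Y) :
    ((t.le n).map F).isColocal f ↔
      ∀ A, t.le n A → Function.Bijective (fun g : F.obj A ⟶ X ↦ g ≫ f) := by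
  refine ⟨fun hf A hA ↦ hf _ ⟨A, hA, ⟨Iso.refl _⟩⟩, fun hf ↦ ?_⟩
  rintro L ⟨A, hA, ⟨e⟩⟩
  refine ⟨fun g₁ g₂ hg ↦ ?_, fun g ↦ ?_⟩
  · rw [← cancel_epi e.hom]
    exact (hf A hA).1 (by simpa using e.hom ≫= hg)
  · obtain ⟨k, hk⟩ := (hf A hA).2 (e.hom ≫ g)
    exact ⟨e.inv ≫ k, by simpa using e.inv ≫= hk⟩

lemma isColocal_map_le_map_iff [F.Full] [F.Faithful] {n : ℤ} {X Y : S} (f : X ⟶ Y) :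
    ((t.le n).map F).isColocal (F.map f) ↔ (t.le n).isColocal f := by
  rw [isColocal_map_le_iff]
  refine forall₂_congr fun A _ ↦ ?_
  have key : (fun g : F.obj A ⟶ F.obj X ↦ g ≫ F.map f) ∘ F.map =
      F.map ∘ (fun g : A ⟶ X ↦ g ≫ f) := by
    ext g
    simp
  have e (X : S) : Function.Bijective (F.map : (A ⟶ X) → _) :=
    ⟨F.map_injective, F.map_surjective⟩
  rw [← Function.Bijective.of_comp_iff _ (e X), key, Function.Bijective.of_comp_iff' (e Y)]

lemma ge_iff_rightOrthogonal_map_le [Preadditive T] [F.Additive]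
    [F.Full] [F.Faithful] (n₀ n₁ : ℤ) (hn : n₀ + 1 = n₁) (A : S) :
    t.ge n₁ A ↔ ((t.le n₀).map F).rightOrthogonal (F.obj A) := by
  rw [t.ge_iff_isGE, t.isGE_iff_orthogonal n₀ n₁ hn]
  constructor
  · rintro h L g ⟨B, hB, ⟨e⟩⟩
    obtain ⟨k, hk⟩ := F.map_surjective (e.hom ≫ g)
    rw [← cancel_epi e.hom, ← hk, h B k ⟨hB⟩, F.map_zero, comp_zero]
  · intro h B f hB
    exact F.map_injective ((h (F.map f) ⟨B, hB.le, ⟨Iso.refl _⟩⟩).trans (F.map_zero _ _).symm)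

lemma isColocal_essImage (ht : IsBoundedAbove t) {X Y : T} {f : X ⟶ Y}
    (hf : ∀ n : ℤ, ((t.le n).map F).isColocal f) : F.essImage.isColocal f := by
  rintro L ⟨A, ⟨e⟩⟩
  obtain ⟨n, hn⟩ := ht A
  exact hf n L ⟨A, hn, ⟨e⟩⟩

/-! ### Homotopy colimits of Cauchy sequences under a good extension -/

section

variable {M : ℕ → ObjectProperty S} [Preadditive T] [HasZeroObject T] [HasShift T ℤ]
  [∀ n : ℤ, (shiftFunctor T n).Additive] [Pretriangulated T] [F.CommShift ℤ]

/-- Mathlib has this for filtered shapes in the universe `v₂` only, whence the lift of `ℕ`. -/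
instance : PreservesColimitsOfShape ℕ (forget AddCommGrpCat.{v₂}) :=
  have := IsFiltered.of_equivalence (ULiftHomULiftCategory.equiv.{v₂, v₂} ℕ)
  preservesColimitsOfShape_of_equiv (ULiftHomULiftCategory.equiv.{v₂, v₂} ℕ).symm _

/-- Morphisms from the image of `F` to the homotopy colimit factor through a term. -/
lemma IsGoodExtension.exists_hom (hF : IsGoodExtension F M) {E : ℕ ⥤ S} (hE : IsCauchy M E)
    {c : Cocone (E ⋙ F)} (hc : IsHomotopyColimit c) {A : S} (g : F.obj A ⟶ c.pt) :
    ∃ (i : ℕ) (g' : F.obj A ⟶ F.obj (E.obj i)), g' ≫ c.ι.app i = g := by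
  obtain ⟨h⟩ := hF.isColimit E hE c hc
  have h' := isColimitOfPreserves ((evaluation _ _).obj (Opposite.op A)) h
  obtain ⟨i, g', hg'⟩ := Concrete.isColimit_exists_rep _ h' g
  exact ⟨i, g', hg'⟩

/-- Morphisms from the image of `F` to a term that agree in the homotopy colimit agree in a later
term. -/
lemma IsGoodExtension.exists_eq (hF : IsGoodExtension F M) {E : ℕ ⥤ S} (hE : IsCauchy M E)
    {c : Cocone (E ⋙ F)} (hc : IsHomotopyColimit c) {A : S} {i : ℕ}
    (g₁ g₂ : F.obj A ⟶ F.obj (E.obj i)) (hg : g₁ ≫ c.ι.app i = g₂ ≫ c.ι.app i) :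
    ∃ (j : ℕ) (hij : i ≤ j),
      g₁ ≫ F.map (E.map (homOfLE hij)) = g₂ ≫ F.map (E.map (homOfLE hij)) := by
  obtain ⟨h⟩ := hF.isColimit E hE c hc
  have h' := isColimitOfPreserves ((evaluation _ _).obj (Opposite.op A)) h
  obtain ⟨j, a, b, hab⟩ := Concrete.isColimit_exists_of_rep_eq _ h' (i := i) (j := i) g₁ g₂ hg
  exact ⟨j, leOfHom a, hab⟩

end

lemma IsCauchy.exists_isColocal {E : ℕ ⥤ S} (hE : IsCauchy (tMetric t) E) (n : ℤ) :
    ∃ N : ℕ, ∀ (i j : ℕ) (hij : i ≤ j), N ≤ i →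
      (t.le n).isColocal (E.map (homOfLE hij)) := by
  obtain ⟨N, hN⟩ := hE (n + 1).toNat
  refine ⟨N, fun i j hij hi ↦ ?_⟩
  obtain rfl | hij' := hij.eq_or_lt
  · have : E.map (homOfLE hij) = 𝟙 _ := E.map_id _
    rw [this]
    exact ObjectProperty.isColocal_of_isIso _ _
  · obtain ⟨D, p, q, hD⟩ := distinguished_cocone_triangle (E.map (homOfLE hij))
    exact isColocal_le_mor₁ t hD n _ rfl
      (t.ge_antitone (Int.self_le_toNat _) _ (hN i j hij' hi D p q hD))

variable [Preadditive T]

variable (t F) in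
/-- An object `X` of `T` is approximable if it is left orthogonal to all objects that are right
orthogonal to the image of `F` (so that `X` is detected by maps from this image), and if for
every `n` some morphism `F A ⟶ X` induces bijections on maps out of the image of `S^{≤ n}`. -/
def IsApproximable : ObjectProperty T :=
  fun X ↦ F.essImage.rightOrthogonal.leftOrthogonal X ∧
    ∀ n : ℤ, ∃ (A : S) (f : F.obj A ⟶ X), ((t.le n).map F).isColocal f

lemma isApproximable_obj (A : S) : IsApproximable t F (F.obj A) :=
  ⟨fun _ f hY ↦ hY f (F.obj_mem_essImage A),
    fun _ ↦ ⟨A, 𝟙 _, ObjectProperty.isColocal_of_isIso _ _⟩⟩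

instance : (IsApproximable t F).IsClosedUnderIsomorphisms where
  of_iso e hX := by
    refine ⟨ObjectProperty.prop_of_iso _ e hX.1, fun n ↦ ?_⟩
    obtain ⟨A, f, hf⟩ := hX.2 n
    exact ⟨A, f ≫ e.hom,
      MorphismProperty.comp_mem _ _ _ hf (ObjectProperty.isColocal_of_isIso _ _)⟩

lemma IsApproximable.exists_le {X : T} (hX : IsApproximable t F X) [F.Full] [F.Faithful] (n : ℤ) :
    ∃ (A : S) (_ : t.le n A) (f : F.obj A ⟶ X), ((t.le n).map F).isColocal f := by
  obtain ⟨A, f, hf⟩ := hX.2 n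
  exact ⟨(t.truncLE n).obj A, TStructure.le_of_isLE t _ _, F.map ((t.truncLEι n).app A) ≫ f,
    MorphismProperty.comp_mem _ _ _ ((isColocal_map_le_map_iff _).2 (isColocal_truncLEι t n A)) hf⟩

/-- The approximations `F (A n) ⟶ X` with `A n` in `S^{≤ n}` form a Cauchy sequence. -/
lemma IsApproximable.exists_cocone {X : T} (hX : IsApproximable t F X) [F.Full] [F.Faithful] :
    ∃ (E : ℕ ⥤ S) (_ : IsCauchy (tMetric t) E) 
      (d : E ⋙ F ⟶ (Functor.const ℕ).obj X),
      ∀ n : ℕ, ((t.le n).map F).isColocal (d.app n) := by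
  choose A hA f hf using fun n : ℕ ↦ hX.exists_le (n : ℤ)
  have ha (n : ℕ) : ∃ a : A n ⟶ A (n + 1), F.map a ≫ f (n + 1) = f n := by
    obtain ⟨a, ha⟩ := (hf (n + 1) (F.obj (A n))
      ⟨_, t.le_monotone (by simp) _ (hA n), ⟨Iso.refl _⟩⟩).2 (f n)
    exact ⟨F.preimage a, by simpa using ha⟩
  choose a ha using ha
  let E : ℕ ⥤ S := Functor.ofSequence a
  let d : E ⋙ F ⟶ (Functor.const ℕ).obj X :=
    NatTrans.ofSequence f (fun n ↦ by
      have : E.map (homOfLE (Nat.le_add_right n 1)) = a n :=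
        Functor.ofSequence_map_homOfLE_succ a n
      rw [Functor.comp_map, this]
      exact (ha n).trans (Category.comp_id _).symm)
  refine ⟨E, fun i ↦ ⟨i, fun m m' h hm D p q hD ↦ ?_⟩, d, hf⟩
  refine t.ge_antitone (Int.ofNat_le.2 hm) _ (ge_obj₃_of_isColocal t hD m ?_)
  refine (isColocal_map_le_map_iff (F := F) _).1 (MorphismProperty.of_postcomp _ _ (f m')
    (isColocal_antitone (map_le_mono t F (Int.ofNat_le.2 h.le)) (hf m')) ?_)
  have hw : F.map (E.map (homOfLE h.le)) ≫ f m' = f m :=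
    (d.naturality (homOfLE h.le)).trans (Category.comp_id _)
  exact hw ▸ hf m

variable [HasZeroObject T] [HasShift T ℤ]
  [∀ n : ℤ, (shiftFunctor T n).Additive] [Pretriangulated T] [F.CommShift ℤ]

/-- The terms of a Cauchy sequence approximate its homotopy colimit. -/
lemma IsGoodExtension.exists_isColocal_ι (hF : IsGoodExtension F (tMetric t)) {E : ℕ ⥤ S}
    (hE : IsCauchy (tMetric t) E) {c : Cocone (E ⋙ F)} (hc : IsHomotopyColimit c) (n : ℤ) :
    ∃ N : ℕ, ∀ i, N ≤ i → ((t.le n).map F).isColocal (c.ι.app i) := by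
  have := hF.full
  have := hF.faithful
  obtain ⟨N, hN⟩ := hE.exists_isColocal n
  refine ⟨N, fun i hi ↦ (isColocal_map_le_iff _).2 fun A hA ↦ ⟨fun g₁ g₂ hg ↦ ?_, fun g ↦ ?_⟩⟩
  · obtain ⟨j, hij, h⟩ := hF.exists_eq hE hc g₁ g₂ hg
    exact ((isColocal_map_le_iff _).1 ((isColocal_map_le_map_iff _).2 (hN i j hij hi)) A hA).1 h
  · obtain ⟨j, g', rfl⟩ := hF.exists_hom hE hc g
    obtain ⟨k, hk⟩ := ((isColocal_map_le_iff _).1 ((isColocal_map_le_map_iff _).2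
      (hN i (max i j) (le_max_left _ _) hi)) A hA).2
        (g' ≫ F.map (E.map (homOfLE (le_max_right _ _))))
    refine ⟨k, ?_⟩
    dsimp only at hk ⊢
    rw [← c.w (homOfLE (le_max_left i j)), ← c.w (homOfLE (le_max_right i j))]
    simpa using hk =≫ c.ι.app (max i j)

/-- Under a good extension, the objects of `𝔏'(S)` are the approximable objects. -/
lemma IsGoodExtension.lPrime_eq (ht : IsBoundedAbove t) (hF : IsGoodExtension F (tMetric t)) :
    LPrime F (tMetric t) = IsApproximable t F := by
  have := hF.full
  have := hF.faithful
  have := hF.isTriangulated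
  have approx {E : ℕ ⥤ S} (hE : IsCauchy (tMetric t) E) {c : Cocone (E ⋙ F)}
      (hc : IsHomotopyColimit c) : IsApproximable t F c.pt := by
    refine ⟨hc.leftOrthogonal _ (fun i ↦ (isApproximable_obj (t := t) (E.obj i)).1), fun n ↦ ?_⟩
    obtain ⟨N, hN⟩ := hF.exists_isColocal_ι hE hc n
    exact ⟨_, _, hN N le_rfl⟩
  ext X
  constructor
  · rintro ⟨E, hE, c, hc, ⟨e⟩⟩
    exact ObjectProperty.prop_of_iso _ e (approx hE hc)
  · intro hX
    obtain ⟨E, hE, d, hd⟩ := hX.exists_cocone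
    have : HasCoproduct (E ⋙ F).obj := hF.hasCoproduct E hE
    obtain ⟨c, hc⟩ := exists_isHomotopyColimit (E ⋙ F)
    obtain ⟨f, hf⟩ := hc.exists_desc ⟨X, d⟩
    have : IsIso f := by
      refine isIso_of_isColocal (isColocal_essImage ht fun n ↦ ?_) (approx hE hc).1 hX.1
      obtain ⟨N, hN⟩ := hF.exists_isColocal_ι hE hc n
      -- the legs of both cocones at a large index are `n`-colocal, and `f` compares them
      refine MorphismProperty.of_precomp _ (c.ι.app (max N n.toNat)) f
        (hN _ (le_max_left _ _)) ?_
      have hn : n ≤ (max N n.toNat : ℕ) := by lia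
      exact (hf _).symm ▸ isColocal_antitone (map_le_mono t F hn) (hd (max N n.toNat))
    exact ⟨E, hE, c, hc, ⟨asIso f⟩⟩

end

/-! ### The triangulated subcategory of approximable objects -/

section

variable {S : Type u₁} [Category.{v₁} S] [Preadditive S] [HasZeroObject S] [HasShift S ℤ]
  [∀ n : ℤ, (shiftFunctor S n).Additive] [Pretriangulated S]
  {T : Type u₂} [Category.{v₂} T] [Preadditive T] [HasZeroObject T] [HasShift T ℤ]
  [∀ n : ℤ, (shiftFunctor T n).Additive] [Pretriangulated T]
  {t : TStructure S} {F : S ⥤ T} [F.CommShift ℤ]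

section

variable [F.IsTriangulated] [F.Full]

open scoped ZeroObject in
instance : (IsApproximable t F).ContainsZero where
  exists_zero := ⟨F.obj 0, F.map_isZero (isZero_zero S), isApproximable_obj 0⟩

instance : (IsApproximable t F).IsStableUnderShift ℤ where
  isStableUnderShiftBy a :=
    { le_shift X hX := by
        refine ⟨ObjectProperty.le_shift _ a _ hX.1, fun n ↦ ?_⟩
        obtain ⟨A, f, hf⟩ := hX.2 (a + n)
        exact ⟨A⟦a⟧, (F.commShiftIso a).hom.app A ≫ f⟦a⟧',
          MorphismProperty.comp_mem _ _ _ (ObjectProperty.isColocal_of_isIso _ _)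
            (isColocal_map_le_shift hf a n rfl)⟩ }

/-- If `X` and `Y` are approximable, then so is the cone of any `X ⟶ Y`. As objects of `S` are
bounded above, an approximation `F A ⟶ X` composed with `X ⟶ Y` factors through any sufficiently
good approximation `F B ⟶ Y`, and the image under `F` of the cone of the resulting map `A ⟶ B`
approximates the cone. -/
lemma isTriangulated_isApproximable (ht : IsBoundedAbove t) :
    (IsApproximable t F).IsTriangulated := by
  have : (IsApproximable t F).IsTriangulatedClosed₃ := .mk' fun D hD h₁ h₂ ↦ by
    refine ⟨ObjectProperty.ext_of_isTriangulatedClosed₃ _ _ hD h₁.1 h₂.1, fun n ↦ ?_⟩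
    obtain ⟨A, f, hf⟩ := h₁.2 (n + 1)
    obtain ⟨m, hm⟩ := ht A
    obtain ⟨B, g, hg⟩ := h₂.2 (max m (n + 1))
    obtain ⟨a', ha'⟩ := (hg (F.obj A)
      ⟨A, t.le_monotone (le_max_left _ _) _ hm, ⟨Iso.refl _⟩⟩).2 (f ≫ D.mor₁)
    obtain ⟨a, rfl⟩ := F.map_surjective a'
    obtain ⟨C, p, q, hC⟩ := distinguished_cocone_triangle a
    have hC' := F.map_distinguished _ hC
    replace hg := isColocal_antitone (map_le_mono t F (le_max_right _ _)) hg
    refine ⟨C, (completeDistinguishedTriangleMorphism _ _ hC' hD f g ha').hom₃, ?_⟩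
    have h := map_le_mono t F (Int.le_add_one le_rfl : n ≤ n + 1)
    exact isColocal_hom₃ hC' hD _ (isColocal_antitone h hf) (isColocal_antitone h hg)
      (isColocal_map_le_shift hf 1 n (add_comm _ _)) (isColocal_map_le_shift hg 1 n (add_comm _ _))
  have : (IsApproximable t F).IsTriangulatedClosed₂ := .of_isTriangulatedClosed₃
  constructor

end

/-! ### The t-structure on approximable objects -/

/-- The truncation triangle of an approximable object. -/
lemma IsApproximable.exists_triangle [IsTriangulated T] [F.IsTriangulated] [F.Full] [F.Faithful]
    {X : T} (hX : IsApproximable t F X) (n : ℤ) :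
    ∃ (A : S) (_ : t.le n A) (Z : T) (_ : ((t.le n).map F).rightOrthogonal Z)
      (f : F.obj A ⟶ X) (g : X ⟶ Z) (h : Z ⟶ (F.obj A)⟦(1 : ℤ)⟧),
      Triangle.mk f g h ∈ distTriang T := by
  obtain ⟨B, f, hf⟩ := hX.2 (n + 1)
  obtain ⟨Z₂, g₂, h₂, hT₂⟩ := distinguished_cocone_triangle f
  have hZ₂ : ((t.le n).map F).rightOrthogonal Z₂ := rightOrthogonal_obj₃ hT₂
    (isColocal_antitone (map_le_mono t F (Int.le_add_one le_rfl)) hf)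
    (isColocal_map_le_shift hf 1 n (add_comm _ _))
  have hT₁ := F.map_distinguished _ (t.triangleLEGE_distinguished n _ rfl B)
  have hZ₁ : ((t.le n).map F).rightOrthogonal (F.obj ((t.truncGE (n + 1)).obj B)) :=
    (ge_iff_rightOrthogonal_map_le n _ rfl _).1 (t.ge_of_isGE _ _)
  obtain ⟨Z, g, h, hT⟩ := distinguished_cocone_triangle (F.map ((t.truncLEι n).app B) ≫ f)
  exact ⟨(t.truncLE n).obj B, t.le_of_isLE _ _, Z,
    ObjectProperty.ext_of_isTriangulatedClosed₂ _ _ (someOctahedron rfl hT₁ hT₂ hT).mem hZ₁ hZ₂,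
    _, g, h, hT⟩

variable (t F) in
/-- The t-structure on the approximable objects: its aisles are the essential images of those of
`S`, and its coaisles are the right orthogonals of these. -/
def approximableTStructure [IsTriangulated T] [F.IsTriangulated] [F.Full] [F.Faithful]
    [(IsApproximable t F).IsTriangulated] :
    TStructure (IsApproximable t F).FullSubcategory where
  le n := ((t.le n).map F).inverseImage (IsApproximable t F).ι
  ge n := ((t.le (n - 1)).map F).rightOrthogonal.inverseImage (IsApproximable t F).ι
  le_shift n a n' h X hX := ((t.le n').map F).prop_of_iso
    (((IsApproximable t F).ι.commShiftIso a).symm.app X) (map_le_shift t F n a n' h _ hX)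
  ge_shift n a n' h X hX := ((t.le (n' - 1)).map F).rightOrthogonal.prop_of_iso
    (((IsApproximable t F).ι.commShiftIso a).symm.app X)
    (rightOrthogonal_shift hX a (map_le_shift t F (n' - 1) (-a) (n - 1) (by lia)))
  zero' X Y f hX hY := (IsApproximable t F).ι.map_injective (by
    rw [Functor.map_zero]
    exact hY _ (by simpa using hX))
  le_zero_le X hX := map_le_mono t F zero_le_one _ hX
  ge_one_le X hX L g hL := hX g (map_le_mono t F (by simp) _ hL)
  exists_triangle_zero_one X := by
    obtain ⟨A, hA, Z, hZ, f, g, h, hT⟩ := X.property.exists_triangle 0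
    let A' : (IsApproximable t F).FullSubcategory := ⟨F.obj A, isApproximable_obj A⟩
    let Z' : (IsApproximable t F).FullSubcategory := ⟨Z,
      ObjectProperty.ext_of_isTriangulatedClosed₃ _ _ hT (isApproximable_obj A) X.property⟩
    refine ⟨A', Z', ⟨A, hA, ⟨Iso.refl _⟩⟩, by simpa using hZ, ObjectProperty.homMk f,
      ObjectProperty.homMk g, ObjectProperty.homMk
        (h ≫ ((IsApproximable t F).ι.commShiftIso (1 : ℤ)).inv.app A'), ?_⟩
    have hh : (h ≫ ((IsApproximable t F).ι.commShiftIso (1 : ℤ)).inv.app A') ≫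
        ((IsApproximable t F).ι.commShiftIso (1 : ℤ)).hom.app A' = h := by
      rw [Category.assoc, Iso.inv_hom_id_app]
      exact Category.comp_id _
    refine isomorphic_distinguished _ hT _
      (Triangle.isoMk _ _ (Iso.refl _) (Iso.refl _) (Iso.refl _) ?_ ?_ ?_)
    · exact (Category.comp_id _).trans (Category.id_comp _).symm
    · exact (Category.comp_id _).trans (Category.id_comp _).symm
    · exact ((congrArg _ (CategoryTheory.Functor.map_id _ _)).trans (Category.comp_id _)).trans
        (hh.trans (Category.id_comp _).symm)

end

/-! ### Truncations of homotopy colimits -/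

section

variable {S : Type u₁} [Category.{v₁} S] [Preadditive S] [HasZeroObject S] [HasShift S ℤ]
  [∀ n : ℤ, (shiftFunctor S n).Additive] [Pretriangulated S] {t : TStructure S}

lemma IsCauchy.eventuallyStable {E : ℕ ⥤ S} (hE : IsCauchy (tMetric t) E) (n : ℤ) :
    EventuallyStable (E ⋙ t.truncLE n) := by
  obtain ⟨N, hN⟩ := hE.exists_isColocal n
  refine ⟨N, fun i j hij hi ↦ ?_⟩
  refine (ObjectProperty.isColocal_iff_isIso _ _ (t.le_of_isLE ((t.truncLE n).obj _) n)
    (t.le_of_isLE ((t.truncLE n).obj _) n)).1 ?_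
  refine MorphismProperty.of_postcomp _ _ _ (isColocal_truncLEι t n _) ?_
  have := (t.truncLEι n).naturality (E.map (homOfLE hij))
  exact this ▸ MorphismProperty.comp_mem _ _ _ (isColocal_truncLEι t n _) (hN i j hij hi)

lemma EventuallyStable.exists_isEventuallyConstantFrom {C : Type u₁} [Category.{v₁} C]
    {A : ℕ ⥤ C} (hA : EventuallyStable A) : ∃ N, ∀ i, N ≤ i → A.IsEventuallyConstantFrom i := by
  obtain ⟨N, hN⟩ := hA
  exact ⟨N, fun i hi j f ↦ hN i j (leOfHom f) hi⟩

variable {T : Type u₂} [Category.{v₂} T] [Preadditive T] [HasZeroObject T] [HasShift T ℤ]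
  [∀ n : ℤ, (shiftFunctor T n).Additive] [Pretriangulated T]
  {F : S ⥤ T} [F.CommShift ℤ]

/-- The truncation `X^{≤ n} ⟶ X` of an approximable object is universal among the morphisms to
`X` from the image of `S^{≤ n}` in `T`. -/
lemma isColocal_truncLEι_hom [IsTriangulated T] [F.IsTriangulated] [F.Full] [F.Faithful]
    [(IsApproximable t F).IsTriangulated] (n : ℤ) (X : (IsApproximable t F).FullSubcategory) :
    ((t.le n).map F).isColocal (((approximableTStructure t F).truncLEι n).app X).hom := by
  rintro L ⟨A, hA, ⟨e⟩⟩
  have h := isColocal_truncLEι (approximableTStructure t F) n X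
    ⟨L, ObjectProperty.prop_of_iso _ e (isApproximable_obj A)⟩ ⟨A, hA, ⟨e⟩⟩
  refine ⟨fun g₁ g₂ hg ↦ ?_, fun g ↦ ?_⟩
  · exact congrArg (·.hom) (h.1 (a₁ := ObjectProperty.homMk g₁) (a₂ := ObjectProperty.homMk g₂)
      (ObjectProperty.hom_ext _ hg))
  · obtain ⟨k, hk⟩ := h.2 (ObjectProperty.homMk g)
    exact ⟨k.hom, congrArg (·.hom) hk⟩

/-- The terms `X_i^{≤ n}` being eventually constant and eventually universal among the morphisms
from the image of `S^{≤ n}` to the homotopy colimit, their colimit is universal too. -/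
lemma IsGoodExtension.exists_isColocal_of_isColimit (hF : IsGoodExtension F (tMetric t))
    {E : ℕ ⥤ S} (hE : IsCauchy (tMetric t) E) {c : Cocone (E ⋙ F)} (hc : IsHomotopyColimit c)
    (n : ℤ) {d : Cocone (E ⋙ t.truncLE n)} (hd : IsColimit d) :
    ((t.le n).map F) (F.obj d.pt) ∧
      ∃ h : F.obj d.pt ⟶ c.pt, ((t.le n).map F).isColocal h ∧
        (∀ i, F.map (d.ι.app i) ≫ h = F.map ((t.truncLEι n).app (E.obj i)) ≫ c.ι.app i) ∧
        ∀ h' : F.obj d.pt ⟶ c.pt,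
          (∀ i, F.map (d.ι.app i) ≫ h' = F.map ((t.truncLEι n).app (E.obj i)) ≫ c.ι.app i) →
            h' = h := by
  have := hF.full
  have := hF.faithful
  obtain ⟨N₁, hN₁⟩ := (hE.eventuallyStable n).exists_isEventuallyConstantFrom
  obtain ⟨N₂, hN₂⟩ := hF.exists_isColocal_ι hE hc n
  let N := max N₁ N₂
  have hN : (E ⋙ t.truncLE n).IsEventuallyConstantFrom N := hN₁ N (le_max_left _ _)
  have : IsIso (d.ι.app N) := hN.isIso_ι_of_isColimit hd
  let k (i : ℕ) : F.obj ((t.truncLE n).obj (E.obj i)) ⟶ c.pt :=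
    F.map ((t.truncLEι n).app (E.obj i)) ≫ c.ι.app i
  have hk (i j : ℕ) (hij : i ≤ j) :
      F.map ((t.truncLE n).map (E.map (homOfLE hij))) ≫ k j = k i := by
    have h₁ := (t.truncLEι n).naturality (E.map (homOfLE hij))
    have h₂ := c.w (homOfLE hij)
    dsimp only [k]
    rw [← Category.assoc, ← F.map_comp, h₁, F.map_comp, Category.assoc]
    exact congrArg _ h₂
  have hdw (i j : ℕ) (hij : i ≤ j) : F.map ((t.truncLE n).map (E.map (homOfLE hij))) ≫
      F.map (d.ι.app j) = F.map (d.ι.app i) := by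
    rw [← F.map_comp]
    exact congrArg F.map (d.w (homOfLE hij))
  let e : F.obj ((t.truncLE n).obj (E.obj N)) ≅ F.obj d.pt := F.mapIso (asIso (d.ι.app N))
  have he : e.hom = F.map (d.ι.app N) := rfl
  refine ⟨⟨_, t.le_of_isLE ((t.truncLE n).obj (E.obj N)) n, ⟨e⟩⟩, e.inv ≫ k N, ?_, fun i ↦ ?_,
    fun h' hh' ↦ ?_⟩
  · exact MorphismProperty.comp_mem _ _ _ (ObjectProperty.isColocal_of_isIso _ _)
      (MorphismProperty.comp_mem _ _ _
        ((isColocal_map_le_map_iff _).2 (isColocal_truncLEι t n _)) (hN₂ N (le_max_right _ _)))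
  · -- beyond `N`, the transition maps can be cancelled
    have h (j : ℕ) (hj : N ≤ j) : F.map (d.ι.app j) ≫ e.inv ≫ k N = k j := by
      have : IsIso ((t.truncLE n).map (E.map (homOfLE hj))) := hN (homOfLE hj)
      rw [← cancel_epi (F.map ((t.truncLE n).map (E.map (homOfLE hj)))), hk N j hj,
        ← Category.assoc, hdw N j hj, ← he, Iso.hom_inv_id_assoc]
    rw [← hdw i (max i N) (le_max_left _ _), Category.assoc, h _ (le_max_right _ _)]
    exact hk i _ _
  · rw [← cancel_epi e.hom, Iso.hom_inv_id_assoc]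
    exact hh' N

end

end MetricCompletion

end

open MetricCompletion in
theorem proposition7
    {S : Type u₁} [Category.{v₁} S] [Preadditive S] [HasZeroObject S] [HasShift S ℤ]
    [∀ n : ℤ, (shiftFunctor S n).Additive] [Pretriangulated S] [IsTriangulated S]
    {T : Type u₂} [Category.{v₂} T] [Preadditive T] [HasZeroObject T] [HasShift T ℤ]
    [∀ n : ℤ, (shiftFunctor T n).Additive] [Pretriangulated T] [IsTriangulated T]
    (t : TStructure S) (ht : IsBoundedAbove t)
    (F : S ⥤ T) [F.CommShift ℤ] (hF : IsGoodExtension F (tMetric t)) :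
    -- `𝔏'(S)` is a triangulated subcategory of `T`, and it has a t-structure `t'` such that:
    ∃ (_ : (LPrime F (tMetric t)).IsTriangulated)
      (t' : TStructure (LPrime F (tMetric t)).FullSubcategory),
      -- the aisle of `t'` is the essential image of the aisle of `t`
      (∀ X : (LPrime F (tMetric t)).FullSubcategory,
        t'.le 0 X ↔ ∃ A : S, t.le 0 A ∧ Nonempty (F.obj A ≅ X.obj)) ∧
      -- the essential image of `F` is the union of the `𝔏'(S)^{≤ n}`
      (∀ X : T, F.essImage X ↔
        ∃ hX : LPrime F (tMetric t) X, ∃ n : ℕ, t'.le n ⟨X, hX⟩) ∧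
      -- `t` is the inverse image of `t'` under `F`
      (∀ (A : S) (hA : LPrime F (tMetric t) (F.obj A)) (n : ℤ),
        (t.le n A ↔ t'.le n ⟨F.obj A, hA⟩) ∧ (t.ge n A ↔ t'.ge n ⟨F.obj A, hA⟩)) ∧
      -- truncations of the homotopy colimit of a Cauchy sequence
      (∀ (E : ℕ ⥤ S), IsCauchy (tMetric t) E →
        ∀ (c : Cocone (E ⋙ F)), IsHomotopyColimit c →
        ∀ (hX : LPrime F (tMetric t) c.pt) (n : ℤ),
          EventuallyStable (E ⋙ t.truncLE n) ∧
          HasColimit (E ⋙ t.truncLE n) ∧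
          -- the unique map `F (colim E^{≤ n}) ⟶ (hocolim F(E))^{≤ n}` compatible with the
          -- maps `F (E i ^{≤ n}) ⟶ F (E i) ⟶ hocolim F(E)` exists and is an isomorphism
          ∀ (d : Cocone (E ⋙ t.truncLE n)), IsColimit d →
            ∃ g : F.obj d.pt ⟶ ((t'.truncLE n).obj ⟨c.pt, hX⟩).obj,
              IsIso g ∧
              (∀ i : ℕ, F.map (d.ι.app i) ≫ g ≫ ((t'.truncLEι n).app ⟨c.pt, hX⟩).hom =
                F.map ((t.truncLEι n).app (E.obj i)) ≫ c.ι.app i) ∧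
              ∀ g' : F.obj d.pt ⟶ ((t'.truncLE n).obj ⟨c.pt, hX⟩).obj,
                (∀ i : ℕ, F.map (d.ι.app i) ≫ g' ≫ ((t'.truncLEι n).app ⟨c.pt, hX⟩).hom =
                  F.map ((t.truncLEι n).app (E.obj i)) ≫ c.ι.app i) → g' = g) := by
  have := hF.full
  have := hF.faithful
  have := hF.isTriangulated
  rw [hF.lPrime_eq ht]
  have hP := isTriangulated_isApproximable (F := F) ht
  refine ⟨hP, approximableTStructure t F, fun X ↦ Iff.rfl, fun X ↦ ⟨?_, ?_⟩, fun A hA n ↦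
    ⟨⟨fun h ↦ ⟨A, h, ⟨Iso.refl _⟩⟩, ?_⟩, ge_iff_rightOrthogonal_map_le (n - 1) n (by lia) A⟩,
    fun E hE c hc hX n ↦ ⟨hE.eventuallyStable n, ?_, fun d hd ↦ ?_⟩⟩
  · rintro ⟨A, ⟨e⟩⟩
    obtain ⟨n, hn⟩ := ht A
    exact ⟨ObjectProperty.prop_of_iso _ e (isApproximable_obj A), n, A, hn, ⟨e⟩⟩
  · rintro ⟨_, n, A, _, ⟨e⟩⟩
    exact ⟨A, ⟨e⟩⟩
  · rintro ⟨B, hB, ⟨e⟩⟩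
    exact (t.le n).prop_of_iso (F.preimageIso e) hB
  · obtain ⟨N, hN⟩ := (hE.eventuallyStable n).exists_isEventuallyConstantFrom
    exact (hN N le_rfl).hasColimit
  · obtain ⟨hd', h, hh, h₁, h₂⟩ := hF.exists_isColocal_of_isColimit hE hc n hd
    have hu := isColocal_truncLEι_hom n (⟨c.pt, hX⟩ : (IsApproximable t F).FullSubcategory)
    obtain ⟨g, hg⟩ := (hu _ hd').2 h
    have hg' : g ≫ (((approximableTStructure t F).truncLEι n).app ⟨c.pt, hX⟩).hom = h := hg
    refine ⟨g, ?_, fun i ↦ hg' ▸ h₁ i, fun g' hg'' ↦ (hu _ hd').1 ?_⟩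
    · refine (ObjectProperty.isColocal_iff_isIso _ _ hd'
        ((approximableTStructure t F).le_of_isLE _ n)).1 ?_
      exact MorphismProperty.of_postcomp _ _ _ hu (hg'.symm ▸ hh)
    · exact (h₂ _ hg'').trans hg'.symm
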